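/- Let $\Delta$ be an irreducible finite crystallographic root system, not necessarily reduced, in a vector space over a field of characteristic $0$. Let $\mathcal L$ be its root lattice (the subgroup generated by $\Delta$), let $\mathcal V$ be its Weyl group, acting on $\mathcal L$, and let $$\mathcal L_{\mathrm{eff}}=\langle v.l-l \mid v\in\mathcal V,\ l\in\mathcal L\rangle$$ be the subgroup of $\mathcal L$ generated by the elements $v.l-l$. Then $$\mathcal L/\mathcal L_{\mathrm{eff}}\cong\begin{cases}\mathbb Z_2&\text{if }\Delta\text{ is of type }A_1,\ B_\ell\ (\ell\ge 2)\text{ or }BC_\ell\ (\ell\ge 1),\\ \{0\}&\text{otherwise.}\end{cases}$$ In the case $\mathcal L/\mathcal L_{\mathrm{eff}}\cong\mathbb Z_2$, the quotient map $\mathcal L\to\mathbb Z_2$ satisfies, for every $\alpha\in\Delta$, $$\alpha\mapsto\begin{cases}1&\text{if }\alpha\text{ is short or the type is }A_1,\\ 0&\text{otherwise.}\end{cases}$$ Here a root is divisible if it is twice another root, and a root is short if it is indivisible and has minimal length (with respect to a positive Weyl-invariant form) among the indivisible roots; all indivisible roots are short if they all have the same length. -/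

import Mathlib

noncomputable section

namespace RootPairing

open Set

section Lattice

variable {ι R M N : Type*} [CommRing R] [AddCommGroup M] [Module R M] [AddCommGroup N]
  [Module R N] (P : RootPairing ι R M N)

/-- The Weyl group preserves the root lattice. -/
theorem weylGroup_smul_mem_rootSpan_int (w : P.weylGroup) (l : P.rootSpan ℤ) :
    w • (l : M) ∈ P.rootSpan ℤ := by
  obtain ⟨l, hl⟩ := l
  induction hl using Submodule.span_induction with
  | mem x hx =>
    obtain ⟨i, rfl⟩ := hx
    rw [P.weylGroup_apply_root]
    exact Submodule.subset_span (mem_range_self _)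
  | zero => simp
  | add x y hx hy h1 h2 =>
    simp only [smul_add] at h1 h2 ⊢
    exact add_mem h1 h2
  | smul a x hx h =>
    rw [smul_comm w a x]
    exact Submodule.smul_mem _ a h

/-- The action `l ↦ w.l` of an element of the Weyl group on the root lattice. -/
def weylAct (w : P.weylGroup) (l : P.rootSpan ℤ) : P.rootSpan ℤ :=
  ⟨w • (l : M), P.weylGroup_smul_mem_rootSpan_int w l⟩

/-- The subgroup of the root lattice generated by all elements `w.l - l`, for `w` in the Weyl
group and `l` in the root lattice. -/
def effLattice : AddSubgroup (P.rootSpan ℤ) :=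
  AddSubgroup.closure {x | ∃ (w : P.weylGroup) (l : P.rootSpan ℤ), x = P.weylAct w l - l}

/-- A root is divisible if it is twice another root. (In a crystallographic root system
the only multiples of a root `α` that can be roots are `±α/2`, `±α`, `±2α`.) -/
def IsDivisible (i : ι) : Prop :=
  ∃ j, P.root i = (2 : ℤ) • P.root j

end Lattice

section Types

variable {ι K M N : Type*} [Field K] [CharZero K] [AddCommGroup M] [Module K M]
  [AddCommGroup N] [Module K N] (P : RootPairing ι K M N)

/-- A root is short if it is indivisible and has minimal length among the indivisible roots.
Squared lengths are `(α | α) = ∑ β, ⟨α, β^∨⟩ ^ 2`, taken with respect to the canonical positive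
Weyl-invariant form. For an irreducible root system the invariant form is unique up to a factor,
so this does not depend on the form. If all indivisible roots have the same length,
they are all short. -/
def IsShortRoot [Fintype ι] [P.IsCrystallographic] (i : ι) : Prop :=
  ¬ P.IsDivisible i ∧
    ∀ j, ¬ P.IsDivisible j → (P.posRootForm ℤ).rootLength i ≤ (P.posRootForm ℤ).rootLength j

/-- Type `A₁`: there are exactly two roots `α` and `-α`. -/
def IsTypeAOne : Prop :=
  ∃ i, range P.root = {P.root i, -P.root i}

variable (K) in
/-- The `i`-th standard basis vector of `K ^ ℓ`. -/
def stdVec {ℓ : ℕ} (i : Fin ℓ) : Fin ℓ → K := Pi.single i 1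

variable (K) in
/-- The standard root system of type `B_ℓ`: the vectors `± ε_i` and `± ε_i ± ε_j`, `i < j`. -/
def standardB (ℓ : ℕ) : Set (Fin ℓ → K) :=
  {v | (∃ i, v = stdVec K i ∨ v = -stdVec K i) ∨
    ∃ i j, i < j ∧ (v = stdVec K i + stdVec K j ∨ v = stdVec K i - stdVec K j ∨
      v = -stdVec K i + stdVec K j ∨ v = -stdVec K i - stdVec K j)}

variable (K) in
/-- The standard root system of type `BC_ℓ`: the roots of `B_ℓ` together with `± 2 ε_i`. -/
def standardBC (ℓ : ℕ) : Set (Fin ℓ → K) :=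
  standardB K ℓ ∪
    {v | ∃ i, v = (2 : K) • stdVec K i ∨ v = -((2 : K) • stdVec K i)}

/-- The root system is isomorphic to the one formed by the set `S` of vectors in `K ^ ℓ`: there is
a linear isomorphism of the ambient spaces that carries one set of roots onto the other one.
(Such a map is compatible with the coroots too, since a finite spanning set of
roots determines its coroots.) -/
def IsIsoToStandard {ℓ : ℕ} (S : Set (Fin ℓ → K)) : Prop :=
  ∃ e : (Fin ℓ → K) ≃ₗ[K] M, e '' S = range P.root

/-- The root system has type `B_ℓ`. -/
def IsTypeB (ℓ : ℕ) : Prop := P.IsIsoToStandard (standardB K ℓ)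

/-- The root system has type `BC_ℓ`. -/
def IsTypeBC (ℓ : ℕ) : Prop := P.IsIsoToStandard (standardBC K ℓ)

/-- The root system has one of the types `A₁`, `B_ℓ` with `ℓ ≥ 2`, `BC_ℓ` with `ℓ ≥ 1`. -/
def IsTypeAOneOrBOrBC : Prop :=
  P.IsTypeAOne ∨ (∃ ℓ, 2 ≤ ℓ ∧ P.IsTypeB ℓ) ∨ (∃ ℓ, 1 ≤ ℓ ∧ P.IsTypeBC ℓ)

end Types

end RootPairing

end

/-! Call a root `α` even if `⟨β, α^∨⟩` is even for every root `β`; everything is controlled by these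
roots. Reflecting `β` in `α` shows that `⟨β, α^∨⟩ α` vanishes in the quotient. In particular `2α`
vanishes, and so does `α` itself unless it is even. All even roots are conjugate up to sign, so they
share one class, and this class generates the quotient. If no root is even, the quotient is trivial.

Suppose now that there is an even root. The possible pairs of Cartan integers show that two even
roots are orthogonal or equal up to sign. Even roots span, so they are `±ε_a` for a basis `ε_a`
(`EvenFrame`), and every other root is `±2ε_a` or `±ε_a ± ε_c` (`EvenFrame.root_cases`).
Irreducibility makes all `±ε_a ± ε_c` occur, which gives type `A₁`, `B` or `BC`. The coordinate sum
mod 2 is 1 exactly on the even roots (`EvenFrame.exists_parity`), hence Weyl-invariant, and the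
quotient is `ZMod 2`. Conversely, in these types `ε_i` is even. Length comparison identifies even
roots with short ones. -/

namespace RootPairing

open Set Submodule

/-! ### Even roots: orthogonality, spanning, transitivity of the Weyl group. -/

section EvenRoots

variable {ι K M N : Type*} [Field K] [CharZero K] [AddCommGroup M] [Module K M]
  [AddCommGroup N] [Module K N] (P : RootPairing ι K M N)

-- A coroot that vanished on a spanning set would be zero, but it takes the value 2 on its own root.
variable {P} in
theorem not_forall_pairing_eq_zero_of_span_eq_top {s : Set ι} (hs : span K (P.root '' s) = ⊤)
    {j : ι}
    (h : ∀ i ∈ s, P.pairing i j = 0) : False := by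
  have : span K (P.root '' s) ≤ LinearMap.ker (P.coroot' j) := by
    rw [span_le]
    rintro _ ⟨i, hi, rfl⟩
    simpa using h i hi
  rw [hs] at this
  have h2 := this (mem_top (x := P.root j))
  simp at h2

variable [P.IsCrystallographic]

/-- A root `α` is even if `⟨β, α^∨⟩` is even for every root `β`. -/
def IsEvenRoot (i : ι) : Prop := ∀ j, Even (P.pairingIn ℤ j i)

variable {P} {i j : ι}

theorem IsEvenRoot.reflectionPerm (hi : P.IsEvenRoot i) (j : ι) :
    P.IsEvenRoot (P.reflectionPerm j i) := by
  intro k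
  rw [pairingIn_reflectionPerm]
  exact hi _

theorem IsEvenRoot.of_root_eq_neg (hi : P.IsEvenRoot i) (h : P.root j = -P.root i) :
    P.IsEvenRoot j := by
  have : j = P.reflectionPerm i i := P.root.injective (by simp [h])
  rw [this]
  exact hi.reflectionPerm i

theorem IsEvenRoot.weylGroupToPerm (hi : P.IsEvenRoot i) (w : P.weylGroup) :
    P.IsEvenRoot (P.weylGroupToPerm w i) := by
  obtain ⟨w, hw⟩ := w
  induction hw using weylGroup.induction generalizing i with
  | mem j => exact hi.reflectionPerm j
  | one => exact hi
  | mul x y hx hy h1 h2 => exact h1 (h2 hi)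

variable [Finite ι]

/-- Among the possible pairs of Cartan integers, only `(0, 0)`, `(2, 2)` and `(-2, -2)` have both
entries even. -/
theorem IsEvenRoot.pairingIn_eq_zero_or (hi : P.IsEvenRoot i) (hj : P.IsEvenRoot j) :
    P.pairingIn ℤ i j = 0 ∨ P.root j = P.root i ∨ P.root j = -P.root i := by
  have h1 := hj i
  have h2 := hi j
  have h := P.pairingIn_pairingIn_mem_set_of_isCrystallographic i j
  simp only [mem_insert_iff, mem_singleton_iff, Prod.mk.injEq] at h
  have h22 := P.pairingIn_two_two_iff ℤ i j
  have hn22 := P.pairingIn_neg_two_neg_two_iff ℤ i j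
  rcases h with h | h | h | h | h | h | h | h | h | h | h | h | h | h | h | h | h
  case inr.inr.inr.inr.inr.inr.inr.inr.inr.inr.inr.inr.inr.inr.inr.inl =>
    exact .inr (.inl (by rw [h22.mp h]))
  case inr.inr.inr.inr.inr.inr.inr.inr.inr.inr.inr.inr.inr.inr.inr.inr =>
    exact .inr (.inr (by rw [hn22.mp h, neg_neg]))
  all_goals
    rw [h.1] at h1 ⊢
    rw [h.2] at h2
    first | (left; rfl) | (exfalso; revert h1 h2; decide)

/-- A root that is not even is either orthogonal to an even root, twice that root up to sign, or
longer than it by a factor `√2`. -/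
theorem IsEvenRoot.pairingIn_cases (hi : P.IsEvenRoot i) (hj : ¬ P.IsEvenRoot j) :
    P.pairingIn ℤ j i = 0 ∨
      (P.root j = (2 : K) • P.root i ∨ P.root j = (-2 : K) • P.root i) ∨
      (P.pairingIn ℤ j i = 2 ∧ P.pairingIn ℤ i j = 1) ∨
      (P.pairingIn ℤ j i = -2 ∧ P.pairingIn ℤ i j = -1) := by
  have h1 := hi j
  have h := P.pairingIn_pairingIn_mem_set_of_isCrystallographic j i
  simp only [mem_insert_iff, mem_singleton_iff, Prod.mk.injEq] at h
  have h22 := P.pairingIn_two_two_iff ℤ j i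
  have hn22 := P.pairingIn_neg_two_neg_two_iff ℤ j i
  have h14 := P.pairingIn_one_four_iff ℤ i j
  have hn14 := P.pairingIn_neg_one_neg_four_iff ℤ i j
  have hne : ¬ (P.pairingIn ℤ j i = 2 ∧ P.pairingIn ℤ i j = 2) := fun h => hj (h22.mp h ▸ hi)
  have hne' : ¬ (P.pairingIn ℤ j i = -2 ∧ P.pairingIn ℤ i j = -2) :=
    fun h => hj (hi.of_root_eq_neg (hn22.mp h))
  rcases h with h | h | h | h | h | h | h | h | h | h | h | h | h | h | h | h | h
  all_goals first
    | exact .inl h.1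
    | exact .inr (.inr (.inl h))
    | exact .inr (.inr (.inr h))
    | exact absurd h hne
    | exact absurd h hne'
    | exact .inr (.inl (.inl (h14.mp h.symm)))
    | exact .inr (.inl (.inr (hn14.mp h.symm)))
    | (rw [h.1] at h1; exfalso; revert h1; decide)

/-- A root that is neither even, nor orthogonal to an even root, nor twice that root up to sign,
is the difference of two orthogonal even roots. -/
theorem IsEvenRoot.exists_root_eq_sub (hi : P.IsEvenRoot i) (hj : ¬ P.IsEvenRoot j)
    (h : P.pairingIn ℤ j i ≠ 0) :
    (P.root j = (2 : K) • P.root i ∨ P.root j = (-2 : K) • P.root i) ∨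
      ∃ k, P.IsEvenRoot k ∧ P.pairing k i = 0 ∧
        (P.root j = P.root i - P.root k ∨ P.root j = P.root k - P.root i) := by
  refine (hi.pairingIn_cases hj).resolve_left h |>.imp_right fun h => ?_
  -- Since `⟨α_i, α_j^∨⟩ = ±1`, the reflected root is `α_i ∓ α_j`; it is again even.
  refine ⟨P.reflectionPerm j i, hi.reflectionPerm j, ?_, ?_⟩
  · rw [← P.root_coroot'_eq_pairing, root_reflectionPerm, reflection_apply_root, map_sub, map_smul,
      P.root_coroot'_eq_pairing, P.root_coroot'_eq_pairing, ← P.algebraMap_pairingIn ℤ i j,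
      ← P.algebraMap_pairingIn ℤ j i]
    rcases h with h | h <;> simp [h.1, h.2]
  · rw [root_reflectionPerm, reflection_apply_root, ← P.algebraMap_pairingIn ℤ]
    rcases h with h | h <;> simp [h.2]

theorem IsEvenRoot.not_isDivisible (hi : P.IsEvenRoot i) : ¬ P.IsDivisible i := by
  rintro ⟨j, h⟩
  have h' : P.root i = (2 : K) • P.root j := by rw [h, two_smul, two_smul]
  have := hi j
  rw [((P.pairingIn_one_four_iff ℤ j i).mpr h').1] at this
  exact absurd this (by decide)

variable [P.IsIrreducible]

-- The Weyl orbit of one even root consists of even roots, and it spans by irreducibility.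
omit [Finite ι] in
theorem IsEvenRoot.span_eq_top (hi : P.IsEvenRoot i) :
    span K (P.root '' {j | P.IsEvenRoot j}) = ⊤ := by
  rw [eq_top_iff, ← P.span_orbit_eq_top i, span_le]
  rintro _ ⟨w, rfl⟩
  simp only [P.weylGroup_apply_root]
  exact subset_span ⟨_, hi.weylGroupToPerm w, rfl⟩

omit [Finite ι] in
theorem IsEvenRoot.exists_pairingIn_ne_zero (hi : P.IsEvenRoot i) (j : ι) :
    ∃ k, P.IsEvenRoot k ∧ P.pairingIn ℤ j k ≠ 0 := by
  by_contra! h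
  refine not_forall_pairing_eq_zero_of_span_eq_top hi.span_eq_top (j := j) fun k hk => ?_
  rw [P.pairing_eq_zero_iff', ← P.algebraMap_pairingIn ℤ, h k hk, map_zero]

/-- The Weyl group acts transitively on the even roots, up to sign. -/
theorem IsEvenRoot.exists_weylGroup_smul_eq (hi : P.IsEvenRoot i) (hj : P.IsEvenRoot j) :
    ∃ w : P.weylGroup, w • P.root i = P.root j ∨ w • P.root i = -P.root j := by
  -- Otherwise the whole orbit of `i` is orthogonal to `j`, although the orbit spans.
  by_contra! h
  have : span K (MulAction.orbit P.weylGroup (P.root i)) ≤ LinearMap.ker (P.coroot' j) := by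
    rw [span_le]
    rintro _ ⟨w, rfl⟩
    specialize h w
    simp only [P.weylGroup_apply_root] at h ⊢
    have := (hi.weylGroupToPerm w).pairingIn_eq_zero_or hj
    rw [SetLike.mem_coe, LinearMap.mem_ker, P.root_coroot'_eq_pairing, ← P.algebraMap_pairingIn ℤ]
    rcases this with h' | h' | h'
    · rw [h', map_zero]
    · exact absurd h'.symm h.1
    · exact absurd (by rw [h', neg_neg]) h.2
  rw [P.span_orbit_eq_top] at this
  have h2 := this (mem_top (x := P.root j))
  simp at h2

end EvenRoots

/-! ### Even roots are the short roots. -/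

section Short

variable {ι K M N : Type*} [Fintype ι] [Field K] [CharZero K] [AddCommGroup M] [Module K M]
  [AddCommGroup N] [Module K N] {P : RootPairing ι K M N} [P.IsCrystallographic]
  {i j : ι}

theorem rootLength_eq_of_weylGroup_smul_eq {w : P.weylGroup}
    (h : w • P.root i = P.root j ∨ w • P.root i = -P.root j) :
    (P.posRootForm ℤ).rootLength i = (P.posRootForm ℤ).rootLength j := by
  apply FaithfulSMul.algebraMap_injective ℤ K
  have hw := InvariantForm.apply_weylGroup_smul P (B := (P.posRootForm ℤ).toInvariantForm) w
    (P.root i) (P.root i)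
  rw [RootPositiveForm.algebraMap_rootLength, RootPositiveForm.algebraMap_rootLength]
  refine hw.symm.trans ?_
  rcases h with h | h <;> rw [h]
  · rfl
  · simp

theorem IsEvenRoot.rootLength_eq_two_mul (hi : P.IsEvenRoot i) (hj : ¬ P.IsEvenRoot j)
    (h : P.pairingIn ℤ j i ≠ 0) (hd : ¬ P.IsDivisible j) :
    (P.posRootForm ℤ).rootLength j = 2 * (P.posRootForm ℤ).rootLength i := by
  have hs := (P.posRootForm ℤ).pairingIn_mul_eq_pairingIn_mul_swap i j
  rcases hi.pairingIn_cases hj with h' | (h' | h') | h' | h'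
  · exact absurd h' h
  · exact absurd ⟨i, by rw [h', two_smul, two_smul]⟩ hd
  · exact absurd ⟨P.reflectionPerm i i, by simp [h', two_smul]⟩ hd
  · rw [h'.1, h'.2] at hs
    linarith
  · rw [h'.1, h'.2] at hs
    linarith

variable [P.IsIrreducible]

/-- If there are even roots, they are exactly the short roots. -/
theorem IsEvenRoot.isShortRoot_iff (hi : P.IsEvenRoot i) : P.IsShortRoot j ↔ P.IsEvenRoot j := by
  constructor
  · rintro ⟨hd, hmin⟩
    by_contra hj
    obtain ⟨k, hk, hjk⟩ := hi.exists_pairingIn_ne_zero j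
    have h1 := hk.rootLength_eq_two_mul hj hjk hd
    have h2 := hmin k hk.not_isDivisible
    have h3 := (P.posRootForm ℤ).rootLength_pos k
    linarith
  · intro hj
    refine ⟨hj.not_isDivisible, fun l hl => ?_⟩
    obtain ⟨k, hk, hlk⟩ := hi.exists_pairingIn_ne_zero l
    obtain ⟨w, hw⟩ := hj.exists_weylGroup_smul_eq hk
    rw [rootLength_eq_of_weylGroup_smul_eq hw]
    by_cases hle : P.IsEvenRoot l
    · obtain ⟨w, hw⟩ := hk.exists_weylGroup_smul_eq hle
      rw [rootLength_eq_of_weylGroup_smul_eq hw]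
    · have h1 := hk.rootLength_eq_two_mul hle hlk hl
      have h3 := (P.posRootForm ℤ).rootLength_pos k
      linarith

end Short

/-! ### The quotient by `effLattice`: relations and invariant homomorphisms. -/

section Quotient

variable {ι R M N : Type*} [CommRing R] [AddCommGroup M] [Module R M]
  [AddCommGroup N] [Module R N] (P : RootPairing ι R M N)

theorem addMonoidHom_rootSpan_eq_zero {G : Type*} [AddCommGroup G] (f : P.rootSpan ℤ →+ G)
    (h : ∀ i, f (P.rootSpanMem ℤ i) = 0) : f = 0 := by
  have : ∀ x (hx : x ∈ P.rootSpan ℤ), f ⟨x, hx⟩ = 0 := by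
    intro x hx
    induction hx using span_induction with
    | mem x hx =>
      obtain ⟨i, rfl⟩ := hx
      exact h i
    | zero => exact f.map_zero
    | add x y hx hy h1 h2 =>
      rw [← AddMemClass.mk_add_mk (hx := hx) (hy := hy), f.map_add, h1, h2, add_zero]
    | smul a x hx h1 =>
      rw [← SetLike.mk_smul_mk _ _ _ hx, map_zsmul, h1, smul_zero]
  ext ⟨x, hx⟩
  exact this x hx

/-- The action of an element of the Weyl group on the root lattice, as a homomorphism. -/
noncomputable def weylActHom (w : P.weylGroup) : P.rootSpan ℤ →+ P.rootSpan ℤ where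
  toFun := P.weylAct w
  map_zero' := Subtype.ext (smul_zero w)
  map_add' x y := Subtype.ext (smul_add w (x : M) (y : M))

theorem weylAct_rootSpanMem (w : P.weylGroup) (i : ι) :
    P.weylAct w (P.rootSpanMem ℤ i) = P.rootSpanMem ℤ (P.weylGroupToPerm w i) :=
  Subtype.ext (P.weylGroup_apply_root w i)

theorem mk_weylAct (w : P.weylGroup) (l : P.rootSpan ℤ) :
    (QuotientAddGroup.mk (P.weylAct w l) : P.rootSpan ℤ ⧸ P.effLattice) =
      QuotientAddGroup.mk l := by
  rw [QuotientAddGroup.eq_iff_sub_mem]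
  exact AddSubgroup.subset_closure ⟨w, l, rfl⟩

variable {P} in
/-- A homomorphism on the root lattice kills `effLattice` as soon as it is invariant
under reflections of roots. -/
theorem effLattice_le_ker {G : Type*} [AddCommGroup G] {f : P.rootSpan ℤ →+ G}
    (h : ∀ i j, f (P.rootSpanMem ℤ (P.reflectionPerm i j)) = f (P.rootSpanMem ℤ j)) :
    P.effLattice ≤ f.ker := by
  have key (w : P.weylGroup) : ∀ j,
      f (P.rootSpanMem ℤ (P.weylGroupToPerm w j)) = f (P.rootSpanMem ℤ j) := by
    obtain ⟨w, hw⟩ := w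
    induction hw using weylGroup.induction with
    | mem i => exact h i
    | one => exact fun _ => rfl
    | mul x y hx hy h1 h2 => exact fun j => (h1 _).trans (h2 j)
  rw [effLattice, AddSubgroup.closure_le]
  rintro _ ⟨w, l, rfl⟩
  have := P.addMonoidHom_rootSpan_eq_zero (f.comp (P.weylActHom w) - f) fun j => by
    rw [AddMonoidHom.sub_apply, sub_eq_zero, AddMonoidHom.comp_apply]
    exact (congrArg f (P.weylAct_rootSpanMem w j)).trans (key w j)
  rw [SetLike.mem_coe, AddMonoidHom.mem_ker, map_sub]
  exact DFunLike.congr_fun this l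

variable [P.IsCrystallographic]

/-- Up to sign, this multiple is the difference between `α_j` and its reflection in `α_i`. -/
theorem pairingIn_zsmul_mk_eq_zero (i j : ι) :
    P.pairingIn ℤ j i •
      (QuotientAddGroup.mk (P.rootSpanMem ℤ i) : P.rootSpan ℤ ⧸ P.effLattice) = 0 := by
  have h := P.mk_weylAct (weylGroup.ofIdx P i) (P.rootSpanMem ℤ j)
  have h' : P.weylAct (weylGroup.ofIdx P i) (P.rootSpanMem ℤ j) =
      P.rootSpanMem ℤ j - P.pairingIn ℤ j i • P.rootSpanMem ℤ i := by
    rw [weylAct_rootSpanMem]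
    apply Subtype.ext
    change P.root (P.reflectionPerm i j) = P.root j - P.pairingIn ℤ j i • P.root i
    rw [root_reflectionPerm, reflection_apply_root, ← P.algebraMap_pairingIn ℤ, algebraMap_smul]
  rw [h', QuotientAddGroup.mk_sub, QuotientAddGroup.mk_zsmul, sub_eq_self] at h
  exact h

theorem two_zsmul_mk_eq_zero [CharZero R] (i : ι) :
    (2 : ℤ) • (QuotientAddGroup.mk (P.rootSpanMem ℤ i) : P.rootSpan ℤ ⧸ P.effLattice) = 0 := by
  simpa using P.pairingIn_zsmul_mk_eq_zero i i

end Quotient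

/-! ### The quotient: classes of even and of other roots. -/

section Field

variable {ι K M N : Type*} [Field K] [CharZero K] [AddCommGroup M] [Module K M]
  [AddCommGroup N] [Module K N] {P : RootPairing ι K M N} [P.IsCrystallographic] {i j : ι}

/-- Both an odd multiple and the double of the class vanish. -/
theorem mk_eq_zero_of_not_isEvenRoot (hi : ¬ P.IsEvenRoot i) :
    (QuotientAddGroup.mk (P.rootSpanMem ℤ i) : P.rootSpan ℤ ⧸ P.effLattice) = 0 := by
  obtain ⟨j, hj⟩ := not_forall.mp hi
  obtain ⟨m, hm⟩ := Int.not_even_iff_odd.mp hj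
  have h := P.pairingIn_zsmul_mk_eq_zero i j
  rwa [hm, add_smul, one_smul, mul_comm, mul_smul, two_zsmul_mk_eq_zero, smul_zero,
    zero_add] at h

theorem subsingleton_quotient_of_forall_not_isEvenRoot (h : ∀ i, ¬ P.IsEvenRoot i) :
    Subsingleton (P.rootSpan ℤ ⧸ P.effLattice) := by
  have h0 := P.addMonoidHom_rootSpan_eq_zero (QuotientAddGroup.mk' P.effLattice)
    fun i => mk_eq_zero_of_not_isEvenRoot (h i)
  refine subsingleton_of_forall_eq 0 fun q => ?_
  obtain ⟨x, rfl⟩ := QuotientAddGroup.mk'_surjective _ q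
  exact DFunLike.congr_fun h0 x

theorem IsEvenRoot.mk_eq_mk [Finite ι] [P.IsIrreducible] (hi : P.IsEvenRoot i)
    (hj : P.IsEvenRoot j) :
    (QuotientAddGroup.mk (P.rootSpanMem ℤ i) : P.rootSpan ℤ ⧸ P.effLattice) =
      QuotientAddGroup.mk (P.rootSpanMem ℤ j) := by
  obtain ⟨w, hw⟩ := hi.exists_weylGroup_smul_eq hj
  rw [← P.mk_weylAct w (P.rootSpanMem ℤ i)]
  rcases hw with hw | hw
  · exact congrArg _ (Subtype.ext hw)
  · have : P.weylAct w (P.rootSpanMem ℤ i) = -P.rootSpanMem ℤ j := Subtype.ext hw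
    rw [this, QuotientAddGroup.mk_neg, neg_eq_iff_add_eq_zero, ← two_zsmul, two_zsmul_mk_eq_zero]

theorem effLattice_le_ker_of_isEvenRoot {f : P.rootSpan ℤ →+ ZMod 2}
    (h1 : ∀ j, P.IsEvenRoot j → f (P.rootSpanMem ℤ j) = 1)
    (h0 : ∀ j, ¬ P.IsEvenRoot j → f (P.rootSpanMem ℤ j) = 0) : P.effLattice ≤ f.ker :=
  effLattice_le_ker fun k j => by
    by_cases hj : P.IsEvenRoot j
    · rw [h1 _ hj, h1 _ (hj.reflectionPerm k)]
    · rw [h0 _ hj, h0 _ fun h => hj (by simpa using h.reflectionPerm k)]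

/-- The quotient of the root lattice by `effLattice`, given a parity function. -/
theorem IsEvenRoot.nonempty_quotient_addEquiv [Finite ι] [P.IsIrreducible] (hi : P.IsEvenRoot i)
    (f : P.rootSpan ℤ →+ ZMod 2) (h1 : ∀ j, P.IsEvenRoot j → f (P.rootSpanMem ℤ j) = 1)
    (h0 : ∀ j, ¬ P.IsEvenRoot j → f (P.rootSpanMem ℤ j) = 0) :
    Nonempty ((P.rootSpan ℤ ⧸ P.effLattice) ≃+ ZMod 2) := by
  have hker := effLattice_le_ker_of_isEvenRoot h1 h0
  set x : P.rootSpan ℤ ⧸ P.effLattice := QuotientAddGroup.mk (P.rootSpanMem ℤ i) with hx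
  have hx2 : (2 : ℤ) • x = 0 := P.two_zsmul_mk_eq_zero i
  -- The inverse of the map induced by `f`: it sends 1 to the common class of the even roots.
  set g : ZMod 2 →+ P.rootSpan ℤ ⧸ P.effLattice :=
    ZMod.lift 2 ⟨zmultiplesHom _ x, by simpa using hx2⟩ with hg
  have hg1 : g 1 = x := by
    have := ZMod.lift_coe 2 ⟨zmultiplesHom (P.rootSpan ℤ ⧸ P.effLattice) x, by simpa using hx2⟩ 1
    simpa using this
  set F := QuotientAddGroup.lift P.effLattice f hker with hF
  have hFx : F x = 1 := h1 i hi
  have hgF := P.addMonoidHom_rootSpan_eq_zero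
    ((g.comp F).comp (QuotientAddGroup.mk' _) - QuotientAddGroup.mk' _) fun j => by
      rw [AddMonoidHom.sub_apply, sub_eq_zero]
      change g (f (P.rootSpanMem ℤ j)) = QuotientAddGroup.mk (P.rootSpanMem ℤ j)
      by_cases hj : P.IsEvenRoot j
      · rw [h1 j hj, hg1, hx, hi.mk_eq_mk hj]
      · rw [h0 j hj, map_zero, mk_eq_zero_of_not_isEvenRoot hj]
  refine ⟨AddMonoidHom.toAddEquiv F g ?_ ?_⟩
  · ext x
    exact sub_eq_zero.mp (DFunLike.congr_fun hgF x)
  · ext y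
    obtain rfl | rfl : y = 0 ∨ y = 1 := by
      revert y
      decide
    · simp
    · simp [hg1, hFx]

end Field

/-! ### Bases of even roots and the shape of the other roots. -/

section Frame

variable {ι K M N : Type*} [Field K] [CharZero K] [AddCommGroup M] [Module K M]
  [AddCommGroup N] [Module K N] (P : RootPairing ι K M N) [P.IsCrystallographic]

/-- A basis of the ambient space that consists of even roots. -/
structure EvenFrame (ℓ : ℕ) where
  basis : Module.Basis (Fin ℓ) K M
  idx : Fin ℓ → ι
  basis_apply : ∀ a, basis a = P.root (idx a)
  isEvenRoot : ∀ a, P.IsEvenRoot (idx a)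

variable {P} {i j : ι} [Finite ι]

omit [P.IsCrystallographic] [Finite ι] [CharZero K] in
theorem reflection_mem_range_root {x : M} (hx : x ∈ range P.root) (i : ι) :
    P.reflection i x ∈ range P.root := by
  obtain ⟨j, rfl⟩ := hx
  exact ⟨_, P.root_reflectionPerm i j⟩

theorem IsEvenRoot.exists_evenFrame [P.IsIrreducible] (hi : P.IsEvenRoot i) :
    ∃ ℓ, Nonempty (P.EvenFrame ℓ) := by
  have hs : ⊤ ≤ span K (P.root '' {j | P.IsEvenRoot j}) := hi.span_eq_top.ge
  set b := Module.Basis.ofSpan hs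
  have hsub := Module.Basis.ofSpan_subset hs
  rw [Module.Basis.coe_ofSpan, Subtype.range_coe] at hsub
  have : Finite ((linearIndepOn_empty K id).extend
      (empty_subset (P.root '' {j | P.IsEvenRoot j}))) :=
    ((toFinite {j | P.IsEvenRoot j}).image _).subset hsub
  obtain ⟨ℓ, ⟨e⟩⟩ := Finite.exists_equiv_fin ((linearIndepOn_empty K id).extend
      (empty_subset (P.root '' {j | P.IsEvenRoot j})))
  choose k hk1 hk2 using fun a => hsub (e.symm a).2
  exact ⟨ℓ, ⟨b.reindex e, k, fun a => by simp [b, hk2], hk1⟩⟩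

namespace EvenFrame

variable {ℓ : ℕ} (F : P.EvenFrame ℓ) {a c d : Fin ℓ}

omit [Finite ι] in
include F in
theorem exists_pairing_ne_zero (j : ι) : ∃ a, P.pairing (F.idx a) j ≠ 0 := by
  by_contra! h
  refine not_forall_pairing_eq_zero_of_span_eq_top (P := P) (s := range F.idx) (j := j) ?_ ?_
  · rw [← F.basis.span_eq, ← range_comp]
    exact congrArg (fun f => span K (range f)) (funext fun a => (F.basis_apply a).symm)
  · rintro _ ⟨a, rfl⟩
    exact h a

/-- An even root is not orthogonal to all of the frame, so it agrees up to sign with a frame vector.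
-/
theorem exists_root_eq (hi : P.IsEvenRoot i) :
    ∃ a, P.root i = F.basis a ∨ P.root i = -F.basis a := by
  obtain ⟨a, ha⟩ := F.exists_pairing_ne_zero i
  refine ⟨a, ?_⟩
  rw [F.basis_apply]
  refine ((F.isEvenRoot a).pairingIn_eq_zero_or hi).resolve_left fun h => ha ?_
  rw [← P.algebraMap_pairingIn ℤ, h, map_zero]

omit [CharZero K] [Finite ι] in
theorem coroot'_basis_self : P.coroot' (F.idx a) (F.basis a) = 2 := by
  rw [F.basis_apply, P.root_coroot'_eq_pairing, P.pairing_same]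

theorem coroot'_basis_of_ne (h : a ≠ c) : P.coroot' (F.idx a) (F.basis c) = 0 := by
  rw [F.basis_apply, P.root_coroot'_eq_pairing, ← P.algebraMap_pairingIn ℤ]
  rcases (F.isEvenRoot c).pairingIn_eq_zero_or (F.isEvenRoot a) with h' | h' | h'
  · rw [h', map_zero]
  · rw [← F.basis_apply, ← F.basis_apply] at h'
    exact absurd (F.basis.injective h') h
  · rw [← F.basis_apply, ← F.basis_apply] at h'
    have := congrArg (fun v => F.basis.repr v a) h'
    simp [h.symm] at this

omit [CharZero K] [Finite ι] in
theorem toLinearMap_basis_self : P.toLinearMap (F.basis a) (P.coroot (F.idx a)) = 2 :=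
  F.coroot'_basis_self

theorem toLinearMap_basis_of_ne (h : a ≠ c) :
    P.toLinearMap (F.basis c) (P.coroot (F.idx a)) = 0 :=
  F.coroot'_basis_of_ne h

/-- The form `-ε_a + ε_c` is covered by `ε_a - ε_c`, as `a` and `c` are unordered. -/
theorem root_cases (hj : ¬ P.IsEvenRoot j) :
    (∃ a, P.root j = (2 : K) • F.basis a ∨ P.root j = (-2 : K) • F.basis a) ∨
    ∃ a c, a ≠ c ∧ (P.root j = F.basis a + F.basis c ∨ P.root j = F.basis a - F.basis c ∨
      P.root j = -F.basis a - F.basis c) := by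
  obtain ⟨a, ha⟩ := F.exists_pairing_ne_zero j
  rw [← P.algebraMap_pairingIn ℤ] at ha
  have ha : P.pairingIn ℤ j (F.idx a) ≠ 0 := by
    rw [ne_eq, P.pairingIn_eq_zero_iff]
    exact fun h => ha (by rw [h, map_zero])
  rcases (F.isEvenRoot a).exists_root_eq_sub hj ha with h | ⟨k, hk, hka, h⟩
  · rw [← F.basis_apply] at h
    exact .inl ⟨a, h⟩
  · obtain ⟨c, hc⟩ := F.exists_root_eq hk
    rw [← F.basis_apply] at h
    right
    have hac : a ≠ c := by
      rintro rfl
      rw [← P.root_coroot'_eq_pairing] at hka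
      rcases hc with hc | hc <;> simp [hc, F.toLinearMap_basis_self] at hka
    rcases hc with hc | hc <;> rcases h with h | h <;> rw [hc] at h
    · exact ⟨a, c, hac, .inr (.inl h)⟩
    · exact ⟨c, a, hac.symm, .inr (.inl h)⟩
    · exact ⟨a, c, hac, .inl (by rw [h, sub_neg_eq_add])⟩
    · exact ⟨c, a, hac.symm, .inr (.inr h)⟩

omit [CharZero K] [Finite ι] in
theorem neg_basis_mem (a : Fin ℓ) : -F.basis a ∈ range P.root := by
  rw [F.basis_apply]
  exact P.neg_root_mem _

/-- Reflection in `ε_c` changes the sign of `ε_c` and fixes `ε_a`. -/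
theorem add_mem_iff_sub_mem (h : a ≠ c) :
    F.basis a + F.basis c ∈ range P.root ↔ F.basis a - F.basis c ∈ range P.root := by
  constructor <;> intro h' <;> have h' := reflection_mem_range_root h' (F.idx c)
  · simpa [reflection_apply, F.toLinearMap_basis_of_ne h.symm, F.toLinearMap_basis_self,
      ← F.basis_apply, two_smul, sub_eq_add_neg] using h'
  · simpa [reflection_apply, F.toLinearMap_basis_of_ne h.symm, F.toLinearMap_basis_self,
      ← F.basis_apply, two_smul, sub_eq_add_neg] using h'

theorem sub_mem_of_root_eq (h : a ≠ c)
    (hj : P.root j = F.basis a + F.basis c ∨ P.root j = F.basis a - F.basis c ∨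
      P.root j = -F.basis a - F.basis c) :
    F.basis a - F.basis c ∈ range P.root := by
  rcases hj with hj | hj | hj
  · exact (F.add_mem_iff_sub_mem h).mp ⟨j, hj⟩
  · exact ⟨j, hj⟩
  · have := P.neg_root_mem j
    rw [hj, neg_sub, sub_neg_eq_add, add_comm] at this
    exact (F.add_mem_iff_sub_mem h).mp this

omit [CharZero K] [Finite ι] in
theorem sub_mem_symm (h : F.basis a - F.basis c ∈ range P.root) :
    F.basis c - F.basis a ∈ range P.root := by
  obtain ⟨j, hj⟩ := h
  rw [← neg_sub, ← hj]
  exact P.neg_root_mem j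

theorem pairing_eq_one_of_root_eq_sub (h : c ≠ d) (hj : P.root j = F.basis c - F.basis d) :
    P.pairing (F.idx c) j = 1 := by
  have h2 : P.pairing j (F.idx c) = 2 := by
    rw [← P.root_coroot'_eq_pairing, hj, map_sub, F.coroot'_basis_self,
      F.coroot'_basis_of_ne h, sub_zero]
  have h2' : P.pairingIn ℤ j (F.idx c) = 2 := by
    rw [← P.algebraMap_pairingIn ℤ] at h2
    exact FaithfulSMul.algebraMap_injective ℤ K (by rw [h2, map_ofNat])
  have hd : P.coroot' (F.idx d) (P.root j) = -2 := by
    rw [hj, map_sub, F.coroot'_basis_self, F.coroot'_basis_of_ne h.symm, zero_sub]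
  -- The pairing `-2` with the coroot of `ε_d` shows that the root is no multiple of `ε_c`.
  have hje : ¬ P.IsEvenRoot j := fun hje => by
    rcases (F.isEvenRoot c).pairingIn_eq_zero_or hje with h' | h' | h'
    · rw [P.pairingIn_eq_zero_iff, h2'] at h'
      exact two_ne_zero h'
    · rw [h', ← F.basis_apply, F.coroot'_basis_of_ne h.symm] at hd
      simp at hd
    · rw [h', ← F.basis_apply, map_neg, F.coroot'_basis_of_ne h.symm] at hd
      simp at hd
  rcases (F.isEvenRoot c).pairingIn_cases hje with h' | (h' | h') | h' | h'
  · omega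
  · rw [h', ← F.basis_apply, map_smul, F.coroot'_basis_of_ne h.symm] at hd
    simp at hd
  · rw [h', ← F.basis_apply, map_smul, F.coroot'_basis_of_ne h.symm] at hd
    simp at hd
  · rw [← P.algebraMap_pairingIn ℤ, h'.2, map_one]
  · omega

/-- Reflection in `ε_c - ε_d` fixes `ε_a` and sends `ε_c` to `ε_d`. -/
theorem sub_mem_trans (had : a ≠ d) (h1 : F.basis a - F.basis c ∈ range P.root)
    (h2 : F.basis c - F.basis d ∈ range P.root) : F.basis a - F.basis d ∈ range P.root := by
  by_cases hcd : c = d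
  · rwa [← hcd]
  by_cases hac : a = c
  · rwa [hac]
  obtain ⟨j, hj⟩ := h2
  have hc := F.pairing_eq_one_of_root_eq_sub hcd hj
  have ha : P.pairing (F.idx a) j = 0 := by
    rw [P.pairing_eq_zero_iff', ← P.root_coroot'_eq_pairing, hj, map_sub,
      F.coroot'_basis_of_ne hac, F.coroot'_basis_of_ne had, sub_zero]
  rw [← P.root_coroot'_eq_pairing, ← F.basis_apply] at hc ha
  have := reflection_mem_range_root h1 j
  rw [reflection_apply, map_sub, hc, ha, hj] at this
  simpa using this

variable [P.IsIrreducible]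

theorem sub_mem (h : a ≠ c) : F.basis a - F.basis c ∈ range P.root := by
  -- The connected component of `a`. A root outside its span is orthogonal to it, so by
  -- irreducibility it spans everything and contains every index.
  set s : Set (Fin ℓ) := {c | a = c ∨ F.basis a - F.basis c ∈ range P.root} with hs
  have himg : P.root '' (F.idx '' s) = F.basis '' s := by
    rw [image_image]
    exact image_congr fun x _ => (F.basis_apply x).symm
  have hmem {x : Fin ℓ} (hx : x ∈ s) : F.basis x ∈ span K (F.basis '' s) :=
    subset_span (mem_image_of_mem _ hx)
  have hclosed {x y : Fin ℓ} (hx : x ∈ s) (h : F.basis x - F.basis y ∈ range P.root) : y ∈ s := by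
    by_cases hay : a = y
    · exact .inl hay
    rcases hx with rfl | hx
    · exact .inr h
    · exact .inr (F.sub_mem_trans hay hx h)
  have htop := P.span_root_image_eq_top_of_forall_orthogonal (F.idx '' s)
    ⟨_, a, .inl rfl, rfl⟩ (by
      rw [himg]
      rintro j hj _ ⟨x, hx, rfl⟩
      refine P.isOrthogonal_iff_pairing_eq_zero.mpr ?_
      by_contra hne
      rw [← P.root_coroot'_eq_pairing] at hne
      by_cases hje : P.IsEvenRoot j
      · obtain ⟨y, hy⟩ := F.exists_root_eq hje
        by_cases hxy : x = y
        · subst hxy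
          rcases hy with hy | hy <;> rw [hy] at hj
          · exact hj (hmem hx)
          · exact hj (neg_mem (hmem hx))
        · rcases hy with hy | hy <;> simp [hy, F.toLinearMap_basis_of_ne hxy] at hne
      · rcases F.root_cases hje with ⟨y, hy⟩ | ⟨y, z, hyz, hyz'⟩
        · by_cases hxy : x = y
          · subst hxy
            rcases hy with hy | hy <;> rw [hy] at hj
            · exact hj (smul_mem _ _ (hmem hx))
            · exact hj (smul_mem _ _ (hmem hx))
          · rcases hy with hy | hy <;> simp [hy, F.toLinearMap_basis_of_ne hxy] at hne
        · have hsub := F.sub_mem_of_root_eq hyz hyz'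
          have hys : y ∈ s ∧ z ∈ s := by
            by_cases hxy : x = y
            · subst hxy
              exact ⟨hx, hclosed hx hsub⟩
            by_cases hxz : x = z
            · subst hxz
              exact ⟨hclosed hx (F.sub_mem_symm hsub), hx⟩
            rcases hyz' with hy | hy | hy <;>
              simp [hy, F.toLinearMap_basis_of_ne hxy, F.toLinearMap_basis_of_ne hxz] at hne
          rcases hyz' with hy | hy | hy <;> rw [hy] at hj
          · exact hj (add_mem (hmem hys.1) (hmem hys.2))
          · exact hj (Submodule.sub_mem _ (hmem hys.1) (hmem hys.2))
          · exact hj (Submodule.sub_mem _ (neg_mem (hmem hys.1)) (hmem hys.2)))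
  rw [himg] at htop
  have hc : F.basis c ∈ span K (F.basis '' s) := htop ▸ mem_top
  rw [F.basis.mem_span_image] at hc
  have := hc (by simp : c ∈ (F.basis.repr (F.basis c)).support)
  exact this.resolve_left h

theorem add_mem (h : a ≠ c) : F.basis a + F.basis c ∈ range P.root :=
  (F.add_mem_iff_sub_mem h).mpr (F.sub_mem h)

theorem neg_sub_mem (h : a ≠ c) : -F.basis a - F.basis c ∈ range P.root := by
  obtain ⟨j, hj⟩ := F.add_mem h
  rw [← neg_add', ← hj]
  exact P.neg_root_mem j

theorem two_smul_mem (a c : Fin ℓ) (h : (2 : K) • F.basis a ∈ range P.root) :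
    (2 : K) • F.basis c ∈ range P.root := by
  obtain ⟨j, hj⟩ := h
  obtain ⟨w, hw⟩ := (F.isEvenRoot a).exists_weylGroup_smul_eq (F.isEvenRoot c)
  rw [← F.basis_apply, ← F.basis_apply] at hw
  have hwj : w • P.root j ∈ range P.root := ⟨_, (P.weylGroup_apply_root w j).symm⟩
  rw [hj, smul_comm] at hwj
  rcases hw with hw | hw <;> rw [hw] at hwj
  · exact hwj
  · obtain ⟨k, hk⟩ := hwj
    have := P.neg_root_mem k
    rwa [hk, smul_neg, neg_neg] at this

end EvenFrame

end Frame

/-! ### Standard root systems, recognition of the types, and the parity map. -/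

section Types

variable {ι K M N : Type*} [Field K] [AddCommGroup M] [Module K M]
  [AddCommGroup N] [Module K N] {P : RootPairing ι K M N}

theorem mem_image_standardB {ℓ : ℕ} (e : (Fin ℓ → K) ≃ₗ[K] M) {x : M} :
    x ∈ e '' standardB K ℓ ↔ (∃ a, x = e (stdVec K a) ∨ x = -e (stdVec K a)) ∨
      ∃ a c, a < c ∧ (x = e (stdVec K a) + e (stdVec K c) ∨ x = e (stdVec K a) - e (stdVec K c) ∨
        x = -e (stdVec K a) + e (stdVec K c) ∨ x = -e (stdVec K a) - e (stdVec K c)) := by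
  rw [show x ∈ e '' standardB K ℓ ↔ e.symm x ∈ standardB K ℓ from
    ⟨by rintro ⟨v, hv, rfl⟩; simpa using hv, fun h => ⟨_, h, by simp⟩⟩]
  simp only [standardB, mem_ofPred_eq, LinearEquiv.symm_apply_eq, map_add, map_sub, map_neg]

theorem mem_image_standardBC {ℓ : ℕ} (e : (Fin ℓ → K) ≃ₗ[K] M) {x : M} :
    x ∈ e '' standardBC K ℓ ↔ x ∈ e '' standardB K ℓ ∨
      ∃ a, x = (2 : K) • e (stdVec K a) ∨ x = -((2 : K) • e (stdVec K a)) := by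
  rw [standardBC, image_union, mem_union]
  refine or_congr_right ⟨?_, ?_⟩
  · rintro ⟨v, ⟨a, ha⟩, rfl⟩
    exact ⟨a, by rcases ha with rfl | rfl <;> simp⟩
  · rintro ⟨a, ha⟩
    rcases ha with rfl | rfl
    · exact ⟨(2 : K) • stdVec K a, ⟨a, .inl rfl⟩, by simp⟩
    · exact ⟨-((2 : K) • stdVec K a), ⟨a, .inr rfl⟩, by simp⟩

/-- The linear map that changes the sign of the `i`-th coordinate. -/
def negCoord {ℓ : ℕ} (i : Fin ℓ) : (Fin ℓ → K) →ₗ[K] (Fin ℓ → K) :=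
  Module.preReflection (stdVec K i) ((2 : K) • LinearMap.proj i)

theorem negCoord_stdVec_self {ℓ : ℕ} (i : Fin ℓ) :
    negCoord i (stdVec K i) = -stdVec K i := by
  simp [negCoord, Module.preReflection_apply, stdVec, two_smul, add_smul]

theorem negCoord_stdVec_of_ne {ℓ : ℕ} {i a : Fin ℓ} (h : i ≠ a) :
    negCoord i (stdVec K a) = stdVec K a := by
  simp [negCoord, Module.preReflection_apply, stdVec, h]

theorem negCoord_mem_standardB {ℓ : ℕ} (i : Fin ℓ) {v : Fin ℓ → K} (hv : v ∈ standardB K ℓ) :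
    negCoord i v ∈ standardB K ℓ := by
  have key (a : Fin ℓ) : negCoord i (stdVec K a) = stdVec K a ∨
      negCoord i (stdVec K a) = -stdVec K a := by
    by_cases h : i = a
    · exact .inr (h ▸ negCoord_stdVec_self i)
    · exact .inl (negCoord_stdVec_of_ne h)
  rcases hv with ⟨a, hv⟩ | ⟨a, c, hac, hv⟩
  · refine .inl ⟨a, ?_⟩
    rcases hv with rfl | rfl <;> rcases key a with h | h <;> simp [h]
  · refine .inr ⟨a, c, hac, ?_⟩
    rcases hv with rfl | rfl | rfl | rfl <;> rcases key a with h | h <;> rcases key c with h' | h' <;>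
      simp [h, h', sub_eq_add_neg]

theorem negCoord_mem_standardBC {ℓ : ℕ} (i : Fin ℓ) {v : Fin ℓ → K} (hv : v ∈ standardBC K ℓ) :
    negCoord i v ∈ standardBC K ℓ := by
  rcases hv with hv | ⟨a, hv⟩
  · exact .inl (negCoord_mem_standardB i hv)
  · refine .inr ⟨a, ?_⟩
    by_cases h : i = a
    · subst h
      rcases hv with rfl | rfl <;> simp [negCoord_stdVec_self]
    · rcases hv with rfl | rfl <;> simp [negCoord_stdVec_of_ne h]

theorem exists_int_of_mem_standardB {ℓ : ℕ} {v : Fin ℓ → K} (hv : v ∈ standardB K ℓ)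
    (i : Fin ℓ) : ∃ n : ℤ, v i = n := by
  have key (a : Fin ℓ) : ∃ n : ℤ, stdVec K a i = n := by
    by_cases h : i = a
    · exact ⟨1, by simp [stdVec, h]⟩
    · exact ⟨0, by simp [stdVec, h]⟩
  rcases hv with ⟨a, hv⟩ | ⟨a, c, hac, hv⟩
  · obtain ⟨m, hm⟩ := key a
    rcases hv with rfl | rfl
    exacts [⟨m, hm⟩, ⟨-m, by simp [hm]⟩]
  · obtain ⟨m, hm⟩ := key a
    obtain ⟨n, hn⟩ := key c
    rcases hv with rfl | rfl | rfl | rfl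
    exacts [⟨m + n, by simp [hm, hn]⟩, ⟨m - n, by simp [hm, hn]⟩, ⟨-m + n, by simp [hm, hn]⟩,
      ⟨-m - n, by simp [hm, hn]⟩]

theorem exists_int_of_mem_standardBC {ℓ : ℕ} {v : Fin ℓ → K} (hv : v ∈ standardBC K ℓ)
    (i : Fin ℓ) : ∃ n : ℤ, v i = n := by
  rcases hv with hv | ⟨a, hv⟩
  · exact exists_int_of_mem_standardB hv i
  · obtain ⟨m, hm⟩ := exists_int_of_mem_standardB (K := K) (.inl ⟨a, .inl rfl⟩) i
    rcases hv with rfl | rfl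
    exacts [⟨2 * m, by simp [hm]⟩, ⟨-(2 * m), by simp [hm]⟩]

variable [CharZero K] [P.IsRootSystem] [P.IsCrystallographic]

theorem IsIsoToStandard.exists_isEvenRoot [Finite ι] {ℓ : ℕ} {S : Set (Fin ℓ → K)}
    (h : P.IsIsoToStandard S)
    (i : Fin ℓ) (hi : stdVec K i ∈ S) (hneg : ∀ v ∈ S, negCoord i v ∈ S)
    (hint : ∀ v ∈ S, ∃ n : ℤ, v i = n) : ∃ k, P.IsEvenRoot k := by
  obtain ⟨e, he⟩ := h
  obtain ⟨k, hk⟩ : e (stdVec K i) ∈ range P.root := he ▸ mem_image_of_mem e hi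
  -- A reflection in a given root that preserves the finite spanning set of roots is unique, so the
  -- coroot is twice the `i`-th coordinate. Integral coordinates then make all pairings even.
  have hco : P.coroot' k = ((2 : K) • LinearMap.proj i).comp e.symm.toLinearMap := by
    refine Module.Dual.eq_of_preReflection_mapsTo (x := P.root k) (finite_range P.root)
      IsRootSystem.span_root_eq_top (by simp) (P.mapsTo_reflection_root k) (by simp [hk, stdVec]) ?_
    rw [← he]
    rintro _ ⟨v, hv, rfl⟩
    refine ⟨_, hneg v hv, ?_⟩
    simp [negCoord, Module.preReflection_apply, hk]
  refine ⟨k, fun j => ?_⟩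
  obtain ⟨v, hv, hvj⟩ : P.root j ∈ e '' S := he ▸ mem_range_self j
  obtain ⟨n, hn⟩ := hint v hv
  refine ⟨n, FaithfulSMul.algebraMap_injective ℤ K ?_⟩
  rw [P.algebraMap_pairingIn, ← P.root_coroot'_eq_pairing, hco, ← hvj]
  simp [hn, two_mul]

omit [P.IsRootSystem] in
theorem IsTypeAOne.isEvenRoot (h : P.IsTypeAOne) (k : ι) : P.IsEvenRoot k := by
  obtain ⟨i, hi⟩ := h
  have hij (j : ι) : j = i ∨ j = P.reflectionPerm i i := by
    have : P.root j ∈ range P.root := mem_range_self j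
    rw [hi] at this
    exact this.imp (fun h => P.root.injective h) (fun h => P.root.injective (by simpa using h))
  have hii : P.IsEvenRoot i := fun j => by
    rcases hij j with rfl | rfl <;> simp
  rcases hij k with rfl | rfl
  exacts [hii, hii.reflectionPerm i]

theorem IsTypeAOneOrBOrBC.exists_isEvenRoot [Finite ι] (h : P.IsTypeAOneOrBOrBC) :
    ∃ i, P.IsEvenRoot i := by
  rcases h with h | ⟨ℓ, hℓ, h⟩ | ⟨ℓ, hℓ, h⟩
  · exact ⟨h.choose, h.isEvenRoot _⟩
  · exact h.exists_isEvenRoot ⟨0, by omega⟩ (.inl ⟨_, .inl rfl⟩)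
      (fun v hv => negCoord_mem_standardB _ hv) fun v hv => exists_int_of_mem_standardB hv _
  · exact h.exists_isEvenRoot ⟨0, by omega⟩ (.inl (.inl ⟨_, .inl rfl⟩))
      (fun v hv => negCoord_mem_standardBC _ hv) fun v hv => exists_int_of_mem_standardBC hv _

namespace EvenFrame

variable [Finite ι] {ℓ : ℕ} (F : P.EvenFrame ℓ)

omit [P.IsRootSystem] [CharZero K] [Finite ι] in
theorem equivFun_symm_stdVec (a : Fin ℓ) : F.basis.equivFun.symm (stdVec K a) = F.basis a := by
  simp [stdVec]

omit [P.IsRootSystem] in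
theorem image_standardB_subset [P.IsIrreducible] :
    F.basis.equivFun.symm '' standardB K ℓ ⊆ range P.root := by
  intro x hx
  rw [mem_image_standardB] at hx
  simp only [F.equivFun_symm_stdVec] at hx
  rcases hx with ⟨a, rfl | rfl⟩ | ⟨a, c, hac, rfl | rfl | rfl | rfl⟩
  · exact ⟨_, (F.basis_apply a).symm⟩
  · exact F.neg_basis_mem a
  · exact F.add_mem hac.ne
  · exact F.sub_mem hac.ne
  · rw [neg_add_eq_sub]
    exact F.sub_mem hac.ne'
  · exact F.neg_sub_mem hac.ne

omit [P.IsRootSystem] in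
theorem root_mem_image_standardB_or (j : ι) :
    P.root j ∈ F.basis.equivFun.symm '' standardB K ℓ ∨
      ∃ a, P.root j = (2 : K) • F.basis a ∨ P.root j = -((2 : K) • F.basis a) := by
  rw [mem_image_standardB]
  simp only [F.equivFun_symm_stdVec]
  by_cases hj : P.IsEvenRoot j
  · exact .inl (.inl (F.exists_root_eq hj))
  rcases F.root_cases hj with ⟨a, h⟩ | ⟨a, c, hac, h⟩
  · exact .inr ⟨a, by simpa only [neg_smul] using h⟩
  · left
    right
    rcases lt_or_gt_of_ne hac with hac | hac
    · exact ⟨a, c, hac, by tauto⟩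
    · refine ⟨c, a, hac, ?_⟩
      rcases h with h | h | h
      · exact .inl (h.trans (add_comm _ _))
      · exact .inr (.inr (.inl (h.trans (by abel))))
      · exact .inr (.inr (.inr (h.trans (by abel))))

omit [P.IsRootSystem] in
include F in
theorem isTypeAOneOrBOrBC [P.IsIrreducible] : P.IsTypeAOneOrBOrBC := by
  have := IsIrreducible.nontrivial P
  have hℓ : 1 ≤ ℓ := by
    by_contra! h
    obtain rfl : ℓ = 0 := by omega
    have := F.basis.equivFun.toEquiv.subsingleton
    exact not_subsingleton M this
  by_cases h2 : ∃ a, (2 : K) • F.basis a ∈ range P.root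
  · obtain ⟨a, ha⟩ := h2
    refine .inr (.inr ⟨ℓ, hℓ, F.basis.equivFun.symm, Subset.antisymm ?_ ?_⟩)
    · intro x hx
      rw [mem_image_standardBC] at hx
      rcases hx with hx | ⟨c, hx⟩
      · exact F.image_standardB_subset hx
      · rw [F.equivFun_symm_stdVec] at hx
        obtain ⟨k, hk⟩ := F.two_smul_mem a c ha
        rcases hx with rfl | rfl <;> rw [← hk]
        exacts [mem_range_self k, P.neg_root_mem k]
    · rintro _ ⟨j, rfl⟩
      rw [mem_image_standardBC]
      simp only [F.equivFun_symm_stdVec]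
      exact F.root_mem_image_standardB_or j
  · have himg : F.basis.equivFun.symm '' standardB K ℓ = range P.root := by
      refine Subset.antisymm F.image_standardB_subset ?_
      rintro _ ⟨j, rfl⟩
      refine (F.root_mem_image_standardB_or j).resolve_right fun ⟨a, ha⟩ => h2 ⟨a, ?_⟩
      rcases ha with ha | ha
      · exact ⟨j, ha⟩
      · rw [eq_neg_iff_add_eq_zero, add_comm, ← eq_neg_iff_add_eq_zero] at ha
        exact ha ▸ P.neg_root_mem j
    -- Without doubled roots, rank one leaves only `±ε`, which is type `A₁`.
    rcases hℓ.eq_or_lt with rfl | hℓ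
    · refine .inl ⟨F.idx 0, ?_⟩
      ext x
      rw [← himg, mem_image_standardB]
      simp [F.equivFun_symm_stdVec, ← F.basis_apply]
    · exact .inr (.inl ⟨ℓ, hℓ, _, himg⟩)

omit [P.IsRootSystem] in
include F in
/-- The parity of the sum of the coordinates with respect to a basis of even roots is the
characteristic function of the set of even roots. -/
theorem exists_parity :
    ∃ f : P.rootSpan ℤ →+ ZMod 2, (∀ j, P.IsEvenRoot j → f (P.rootSpanMem ℤ j) = 1) ∧
      ∀ j, ¬ P.IsEvenRoot j → f (P.rootSpanMem ℤ j) = 0 := by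
  set s : M →ₗ[K] K := F.basis.constr K fun _ => 1 with hs
  have hsb (a : Fin ℓ) : s (F.basis a) = 1 := by simp [hs]
  have h1 (j : ι) (hj : P.IsEvenRoot j) : ∃ n : ℤ, (n : ZMod 2) = 1 ∧ s (P.root j) = n := by
    obtain ⟨a, h | h⟩ := F.exists_root_eq hj
    exacts [⟨1, by decide, by simp [h, hsb]⟩, ⟨-1, by decide, by simp [h, hsb]⟩]
  have h0 (j : ι) (hj : ¬ P.IsEvenRoot j) : ∃ n : ℤ, (n : ZMod 2) = 0 ∧ s (P.root j) = n := by
    rcases F.root_cases hj with ⟨a, h | h⟩ | ⟨a, c, -, h | h | h⟩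
    · exact ⟨2, by decide, by simp [h, hsb]⟩
    · exact ⟨-2, by decide, by simp [h, hsb]⟩
    · exact ⟨2, by decide, by norm_num [h, hsb]⟩
    · exact ⟨0, by decide, by simp [h, hsb]⟩
    · exact ⟨-2, by decide, by norm_num [h, hsb]⟩
  have hint (x : P.rootSpan ℤ) : ∃ n : ℤ, (n : K) = s x := by
    obtain ⟨x, hx⟩ := x
    have hle : P.rootSpan ℤ ≤
        (LinearMap.range (Algebra.linearMap ℤ K)).comap (s.restrictScalars ℤ) := by
      rw [span_le]
      rintro _ ⟨j, rfl⟩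
      by_cases hj : P.IsEvenRoot j
      · obtain ⟨n, -, hn⟩ := h1 j hj
        exact ⟨n, by simp [hn]⟩
      · obtain ⟨n, -, hn⟩ := h0 j hj
        exact ⟨n, by simp [hn]⟩
    obtain ⟨n, hn⟩ := hle hx
    exact ⟨n, hn⟩
  -- The coordinate sum is integral on the root lattice; characteristic zero makes the integer
  -- unique, hence `g` additive.
  choose g hg using hint
  have hgn (x : P.rootSpan ℤ) (n : ℤ) (h : s x = n) : g x = n :=
    Int.cast_injective (α := K) ((hg x).trans h)
  have hadd (x y : P.rootSpan ℤ) : g (x + y) = g x + g y := by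
    apply hgn
    rw [Int.cast_add, hg, hg, coe_add, map_add]
  refine ⟨AddMonoidHom.mk' (fun x => (g x : ZMod 2)) fun x y => ?_, fun j hj => ?_, fun j hj => ?_⟩
  · rw [hadd, Int.cast_add]
  · obtain ⟨n, hn, hsn⟩ := h1 j hj
    rw [AddMonoidHom.mk'_apply, hgn (P.rootSpanMem ℤ j) n hsn, hn]
  · obtain ⟨n, hn, hsn⟩ := h0 j hj
    rw [AddMonoidHom.mk'_apply, hgn (P.rootSpanMem ℤ j) n hsn, hn]

end EvenFrame

end Types

end RootPairing

theorem mainTheorem9 {ι K M N : Type*} [Fintype ι] [Field K] [CharZero K]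
    [AddCommGroup M] [Module K M] [AddCommGroup N] [Module K N]
    (P : RootPairing ι K M N) [P.IsRootSystem] [P.IsCrystallographic] [P.IsIrreducible] :
    (P.IsTypeAOneOrBOrBC →
      Nonempty ((P.rootSpan ℤ ⧸ P.effLattice) ≃+ ZMod 2) ∧
      ∀ e : (P.rootSpan ℤ ⧸ P.effLattice) ≃+ ZMod 2, ∀ i : ι,
        ((P.IsShortRoot i ∨ P.IsTypeAOne) →
          e (QuotientAddGroup.mk (P.rootSpanMem ℤ i)) = 1) ∧
        (¬ (P.IsShortRoot i ∨ P.IsTypeAOne) →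
          e (QuotientAddGroup.mk (P.rootSpanMem ℤ i)) = 0)) ∧
    (¬ P.IsTypeAOneOrBOrBC →
      Subsingleton (P.rootSpan ℤ ⧸ P.effLattice)) := by
  refine ⟨fun h => ?_, fun h => ?_⟩
  · obtain ⟨i₀, hi₀⟩ := h.exists_isEvenRoot
    obtain ⟨ℓ, ⟨F⟩⟩ := hi₀.exists_evenFrame
    obtain ⟨f, hf1, hf0⟩ := F.exists_parity
    refine ⟨hi₀.nonempty_quotient_addEquiv f hf1 hf0, fun e i => ?_⟩
    -- In type `A₁` every root is even, so that alternative adds nothing.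
    have hiff : P.IsShortRoot i ∨ P.IsTypeAOne ↔ P.IsEvenRoot i := by
      rw [hi₀.isShortRoot_iff, or_iff_left_of_imp fun hA => hA.isEvenRoot i]
    rw [hiff]
    refine ⟨fun hi => ?_, fun hi => ?_⟩
    · have hne : e (QuotientAddGroup.mk (P.rootSpanMem ℤ i)) ≠ 0 := fun h0 => by
        rw [map_eq_zero_iff e e.injective, QuotientAddGroup.eq_zero_iff] at h0
        exact one_ne_zero ((hf1 i hi).symm.trans
          (RootPairing.effLattice_le_ker_of_isEvenRoot hf1 hf0 h0))
      generalize e (QuotientAddGroup.mk (P.rootSpanMem ℤ i)) = z at hne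
      revert z
      decide
    · rw [RootPairing.mk_eq_zero_of_not_isEvenRoot hi, map_zero]
  · refine RootPairing.subsingleton_quotient_of_forall_not_isEvenRoot fun i hi => h ?_
    obtain ⟨ℓ, ⟨F⟩⟩ := hi.exists_evenFrame
    exact F.isTypeAOneOrBOrBC
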